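/- Let $d\ge 2$. For a frame $\chi=\{\psi_i\}_{i=1}^N$ of unit vectors in $\mathbb{C}^d$ put $$\mathcal{E}_k(\chi)=\frac1{N^2}\sum_{i,j=1}^N|\langle\psi_i|\psi_j\rangle|^{2k},\qquad \mathcal F_k(\chi)=\frac1N\sum_{i=1}^N(|\psi_i\rangle\langle\psi_i|)^{\otimes k},\qquad \rho_k=\frac{\Pi_k}{\mathrm{Tr}\,\Pi_k},$$ where $\Pi_k$ is the projector onto the symmetric subspace $\vee^k\mathbb{C}^d\subset(\mathbb{C}^d)^{\otimes k}$. The frame $\chi$ is a (complex projective) $k$-design if $\frac1N\sum_i p(\psi_i)=\mathbb{E}_{\phi\sim\mathrm{Haar}}[p(\phi)]$ for every polynomial $p$ that is bihomogeneous of degree $(k,k)$ in the amplitudes and their complex conjugates. The average error is $$\epsilon^{(k)}_{\mathrm{avg}}(\chi)=\Bigl(\mathbb{E}_{M}\Bigl[\|M\|_2^{-2}\,\bigl|\mathbb{E}_{\phi\sim\mathrm{Haar}}[p_M(\phi)]-\tfrac1N\textstyle\sum_i p_M(\psi_i)\bigr|^2\Bigr]\Bigr)^{1/2},\qquad p_M(\phi)=\langle\phi|^{\otimes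 k}M|\phi\rangle^{\otimes k},$$ where $M$ is a Ginibre random operator on $\vee^k\mathbb{C}^d$ (independent standard complex Gaussian matrix entries in an orthonormal basis) and $\|\cdot\|_2$ is the Hilbert–Schmidt norm. Then: 1. Every $1$-design $\chi$ in $\mathbb{C}^d$ with $|\chi|=d(d+1)$ satisfies $\mathcal{E}_3(\chi)\ge \frac1{d^2}$. 2. If there is a complete set of mutually unbiased bases of $\mathbb{C}^d$, that is, $d+1$ orthonormal bases such that $|\langle e|f\rangle|^2=\frac1d$ whenever $e,f$ belong to different bases, then the frame $\chi_{\mathrm{MUB}}$ of its $d(d+1)$ vectors is a $2$-design (hence a $1$-design), satisfies $\mathcal{E}_3(\chi_{\mathrm{MUB}})=\frac1{d^2}$, and is an optimal approximate $3$-design of its cardinality: among all $1$-designs of size $d(d+1)$ it minimizes $\mathcal{E}_3(\chi)$, $\|\mathcal F_3(\chi)-\rho_3\|_2$ and $\epsilon^{(3)}_{\mathrm{avg}}(\chi)$. 3. Every $2$-design $\chi$ in $\mathbb{C}^d$ with $|\chi|=d^2$ satisfies $\mathcal{E}_3(\chi)\ge\frac{d+3}{d(d+1)^2}$. 4. If $\chi_{\mathrm{SIC}}$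 is a SIC in $\mathbb{C}^d$, that is, $d^2$ unit vectors with $|\langle\psi_i|\psi_j\rangle|^2=\frac1{d+1}$ for $i\ne j$, then $\chi_{\mathrm{SIC}}$ is a $2$-design, satisfies $\mathcal{E}_3(\chi_{\mathrm{SIC}})=\frac{d+3}{d(d+1)^2}$, and among all $2$-designs of size $d^2$ it minimizes $\mathcal{E}_3(\chi)$, $\|\mathcal F_3(\chi)-\rho_3\|_2$ and $\epsilon^{(3)}_{\mathrm{avg}}(\chi)$. -/

import Mathlib

noncomputable section

namespace ProjectiveDesign

open MeasureTheory

/-- The Hilbert space `ℂ^d` with its Hermitian inner product. -/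
abbrev H (d : ℕ) : Type := EuclideanSpace ℂ (Fin d)

/-- A frame in `ℂ^d`: a finite family of unit vectors, indexed by `ι`. -/
structure Frame (d : ℕ) (ι : Type*) where
  vec : ι → H d
  norm_vec : ∀ i, ‖vec i‖ = 1

/-- The `k`-frame potential `𝓔_k(χ) = N⁻² ∑_{i,j} |⟨ψ_i|ψ_j⟩|^{2k}`. -/
def framePotential {d : ℕ} {ι : Type*} [Fintype ι] (k : ℕ) (χ : Frame d ι) : ℝ :=
  1 / (Fintype.card ι : ℝ) ^ 2 * ∑ i, ∑ j, ‖inner ℂ (χ.vec i) (χ.vec j)‖ ^ (2 * k)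

/-- Lebesgue measure on `ℂ^d`. -/
def lebesgue (d : ℕ) : Measure (H d) :=
  (volume : Measure (Fin d → ℂ)).map (WithLp.toLp 2)

/-- The Haar average over pure states: the average with respect to the normalized (unitarily
invariant) surface measure of the unit sphere of `ℂ^d`. It is only applied to functions that do
not depend on the phase of the vector, that is, to functions on projective space. -/
def haarMean {d : ℕ} (f : H d → ℂ) : ℂ :=
  ⨍ φ : Metric.sphere (0 : H d) 1, f φ ∂(lebesgue d).toSphere

/-- The average over a frame, `N⁻¹ ∑ i, f(ψ_i)`. -/
def frameMean {d : ℕ} {ι : Type*} [Fintype ι] (χ : Frame d ι) (f : H d → ℂ) : ℂ :=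
  1 / (Fintype.card ι : ℂ) * ∑ i, f (χ.vec i)

/-- Bihomogeneous polynomials of degree `(k,k)`. The variables `Sum.inl i` stand for the
amplitudes, the variables `Sum.inr i` for their complex conjugates. -/
def IsBihomogeneous {d : ℕ} (k : ℕ) (p : MvPolynomial (Fin d ⊕ Fin d) ℂ) : Prop :=
  ∀ m ∈ p.support, ∑ i, m (Sum.inl i) = k ∧ ∑ i, m (Sum.inr i) = k

/-- The value of such a polynomial at a vector. -/
def evalAt {d : ℕ} (p : MvPolynomial (Fin d ⊕ Fin d) ℂ) (φ : H d) : ℂ :=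
  MvPolynomial.eval (Sum.elim (fun i => φ i) (fun i => star (φ i))) p

/-- Complex projective `k`-designs: the frame average of every bihomogeneous polynomial of degree
`(k,k)` is its Haar average. -/
def IsDesign {d : ℕ} {ι : Type*} [Fintype ι] (k : ℕ) (χ : Frame d ι) : Prop :=
  ∀ p : MvPolynomial (Fin d ⊕ Fin d) ℂ, IsBihomogeneous k p →
    haarMean (evalAt p) = frameMean χ (evalAt p)

/-- The `k`-fold tensor power of a vector, as an element of
`(ℂ^d)^{⊗k} = ℂ^(Fin k → Fin d)` (coordinates in the product basis). -/
def tensorPow {d : ℕ} (k : ℕ) (φ : H d) : EuclideanSpace ℂ (Fin k → Fin d) :=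
  WithLp.toLp 2 fun a => ∏ r, φ (a r)

/-- The frame operator `𝓕_k(χ) = N⁻¹ ∑ i, |ψ_i⟩⟨ψ_i|^{⊗k}`. -/
def frameOp {d : ℕ} {ι : Type*} [Fintype ι] (k : ℕ) (χ : Frame d ι) :
    Matrix (Fin k → Fin d) (Fin k → Fin d) ℂ :=
  (1 / (Fintype.card ι : ℂ)) •
    ∑ i, Matrix.of fun a b => tensorPow k (χ.vec i) a * star (tensorPow k (χ.vec i) b)

/-- The operator permuting the tensor factors. -/
def permOp (d : ℕ) {k : ℕ} (σ : Equiv.Perm (Fin k)) :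
    Matrix (Fin k → Fin d) (Fin k → Fin d) ℂ :=
  Matrix.of fun a b => if a = b ∘ σ.symm then 1 else 0

/-- The projector `Π_k` onto the symmetric subspace. -/
def symProj (d k : ℕ) : Matrix (Fin k → Fin d) (Fin k → Fin d) ℂ :=
  (1 / (k.factorial : ℂ)) • ∑ σ : Equiv.Perm (Fin k), permOp d σ

/-- The Haar moment operator `ρ_k = Π_k / Tr Π_k`. -/
def rho (d k : ℕ) : Matrix (Fin k → Fin d) (Fin k → Fin d) ℂ :=
  (1 / (symProj d k).trace) • symProj d k

/-- The Frobenius (Hilbert-Schmidt) norm of a matrix. -/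
def frobNorm {n : Type*} [Fintype n] (A : Matrix n n ℂ) : ℝ :=
  Real.sqrt (∑ a, ∑ b, ‖A a b‖ ^ 2)

/-- The symmetric subspace of `(ℂ^d)^{⊗k}`. -/
def symSubspace (d k : ℕ) : Submodule ℂ (EuclideanSpace ℂ (Fin k → Fin d)) where
  carrier := {v | ∀ (σ : Equiv.Perm (Fin k)) (a : Fin k → Fin d), v (a ∘ σ) = v a}
  add_mem' := by
    intro v w hv hw σ a
    simp [hv σ a, hw σ a]
  zero_mem' := by
    intro σ a
    simp
  smul_mem' := by
    intro c v hv σ a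
    simp [hv σ a]

theorem tensorPow_mem {d : ℕ} (k : ℕ) (φ : H d) : tensorPow k φ ∈ symSubspace d k := by
  intro σ a
  exact Equiv.prod_comp σ fun r => φ (a r)

/-- The tensor power of a vector as an element of the symmetric subspace. -/
def symPow {d : ℕ} (k : ℕ) (φ : H d) : symSubspace d k := ⟨tensorPow k φ, tensorPow_mem k φ⟩

/-- Operators on the symmetric subspace. -/
abbrev SymOp (d k : ℕ) : Type := symSubspace d k →ₗ[ℂ] symSubspace d k

/-- An orthonormal basis of the symmetric subspace. -/
def symBasis (d k : ℕ) :
    OrthonormalBasis (Fin (Module.finrank ℂ (symSubspace d k))) ℂ (symSubspace d k) :=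
  stdOrthonormalBasis ℂ (symSubspace d k)

/-- The polynomial function `p(φ) = ⟨φ|^{⊗k} M |φ⟩^{⊗k}` given by an operator `M`. -/
def symPoly {d k : ℕ} (M : SymOp d k) (φ : H d) : ℂ :=
  inner ℂ (symPow k φ) (M (symPow k φ))

/-- The Hilbert-Schmidt norm `‖M‖₂` of an operator on the symmetric subspace. -/
def hsNorm {d k : ℕ} (M : SymOp d k) : ℝ :=
  Real.sqrt (∑ i, ‖M (symBasis d k i)‖ ^ 2)

/-- The standard complex Gaussian law: independent real and imaginary parts of variance `1/2`. -/
def complexGaussian : Measure ℂ :=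
  ((ProbabilityTheory.gaussianReal 0 (1 / 2)).prod
    (ProbabilityTheory.gaussianReal 0 (1 / 2))).map fun z => (⟨z.1, z.2⟩ : ℂ)

/-- The Ginibre ensemble: square matrices with independent standard complex Gaussian entries. -/
def ginibre (n : Type*) [Fintype n] : Measure (n → n → ℂ) :=
  Measure.pi fun _ => Measure.pi fun _ => complexGaussian

/-- The operator on the symmetric subspace with the given matrix in the chosen orthonormal basis.
The law of this operator under `ginibre` does not depend on the basis. -/
def opOfMatrix (d k : ℕ)
    (X : Fin (Module.finrank ℂ (symSubspace d k)) →
      Fin (Module.finrank ℂ (symSubspace d k)) → ℂ) : SymOp d k :=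
  Matrix.toLin (symBasis d k).toBasis (symBasis d k).toBasis (Matrix.of X)

/-- The average error `ε_avg^{(k)}(χ)`: the root mean square, over a Ginibre-random operator `M`
on the symmetric subspace, of `‖M‖₂⁻¹ |𝔼_Haar p_M - 𝔼_χ p_M|`. -/
def avgError {d : ℕ} {ι : Type*} [Fintype ι] (k : ℕ) (χ : Frame d ι) : ℝ :=
  Real.sqrt (∫ X, (hsNorm (opOfMatrix d k X) ^ 2)⁻¹ *
      ‖haarMean (symPoly (opOfMatrix d k X)) - frameMean χ (symPoly (opOfMatrix d k X))‖ ^ 2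
    ∂(ginibre (Fin (Module.finrank ℂ (symSubspace d k)))))

/-- `χ` is an optimal approximate `k`-design among the exact `k'`-designs of its cardinality: it is
a `k'`-design, and among all `k'`-designs of the same cardinality it minimizes the frame potential
`𝓔_k`, the distance `‖𝓕_k - ρ_k‖₂`, and the average error `ε_avg^{(k)}`. -/
def IsOptimalApproxDesign {d : ℕ} {ι : Type*} [Fintype ι] (k' k : ℕ) (χ : Frame d ι) : Prop :=
  IsDesign k' χ ∧
    ∀ χ' : Frame d (Fin (Fintype.card ι)), IsDesign k' χ' →
      framePotential k χ ≤ framePotential k χ' ∧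
      frobNorm (frameOp k χ - rho d k) ≤ frobNorm (frameOp k χ' - rho d k) ∧
      avgError k χ ≤ avgError k χ'

/-- A complete set of mutually unbiased bases of `ℂ^d`. -/
structure CompleteMUB (d : ℕ) where
  basis : Fin (d + 1) → OrthonormalBasis (Fin d) ℂ (H d)
  unbiased : ∀ α β, α ≠ β → ∀ i j, ‖inner ℂ (basis α i) (basis β j)‖ ^ 2 = 1 / (d : ℝ)

/-- The frame of all `d(d+1)` vectors of a complete set of mutually unbiased bases. -/
def CompleteMUB.frame {d : ℕ} (B : CompleteMUB d) : Frame d (Fin (d + 1) × Fin d) where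
  vec x := B.basis x.1 x.2
  norm_vec x := (B.basis x.1).norm_eq_one x.2

/-- A SIC in `ℂ^d`: `d²` unit vectors with all pairwise squared overlaps equal to `1/(d+1)`. -/
def IsSIC {d : ℕ} (χ : Frame d (Fin (d ^ 2))) : Prop :=
  ∀ i j, i ≠ j → ‖inner ℂ (χ.vec i) (χ.vec j)‖ ^ 2 = 1 / ((d : ℝ) + 1)

end ProjectiveDesign

end

open ProjectiveDesign

noncomputable section

namespace ProjectiveDesign

open MeasureTheory Finset

/-! Let `S_k` be the sum of the `k`-th powers of the squared overlaps of distinct frame vectors, so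
that `N² 𝓔_k = N + S_k`. Cauchy–Schwarz gives `S_2² ≤ S_1 S_3` (`offDiagPotential_two_sq_le`). A
1-design fixes `S_1`, and `S_2` is bounded below by the Welch bound, or known exactly for a
2-design; this yields both lower bounds on `𝓔_3`. Complete MUBs and SICs have a single nonzero
off-diagonal overlap, the equality case of Cauchy–Schwarz, and their potentials are evaluated
directly.

Everything else rests on `‖𝓕_k - ρ_k‖₂² = 𝓔_k - 1 / Tr Π_k` (`frobNorm_frameOp_sub_rho_sq`). It
gives the Welch bound, shows that equality means `𝓕_k = ρ_k`, and makes minimizing the distance the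
same as minimizing `𝓔_k`. The link with designs is that `ρ_k` collects the Haar moments
(`haarMean_moment`): Gaussian integrals of monomials factor over coordinates, match the entries of
`Π_k`, and descend to the sphere in polar coordinates.

For the average error, `p_M` is linear in the entries of `M`, and sign and permutation symmetry of
the Ginibre law make its normalized second moment isotropic
(`exists_integral_normalized_linearForm`). Hence the squared average error is a universal
nonnegative constant times `‖𝓕_k - ρ_k‖₂²`. -/

/-- The monomial `∏ φ_{a r} ∏ conj φ_{b r}`, the `(a, b)` entry of `|φ⟩⟨φ|^{⊗k}`. -/
def moment {d k : ℕ} (a b : Fin k → Fin d) (φ : H d) : ℂ :=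
  tensorPow k φ a * star (tensorPow k φ b)

theorem frameOp_apply {d k : ℕ} {ι : Type*} [Fintype ι] (χ : Frame d ι) (a b : Fin k → Fin d) :
    frameOp k χ a b = frameMean χ (moment a b) := by
  simp [frameOp, frameMean, moment, Matrix.sum_apply]

/-! ### The symmetric projector and the distance from frame operator to Haar moment operator -/

theorem symProj_apply {d k : ℕ} (a b : Fin k → Fin d) :
    symProj d k a b =
      1 / (k.factorial : ℂ) * ∑ σ : Equiv.Perm (Fin k), if a = b ∘ σ.symm then 1 else 0 := by
  simp [symProj, permOp, Matrix.sum_apply]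

theorem symProj_comm {d k : ℕ} (a b : Fin k → Fin d) : symProj d k a b = symProj d k b a := by
  rw [symProj_apply, symProj_apply]
  congr 1
  refine Fintype.sum_equiv (Equiv.inv _) _ _ fun σ => ?_
  have hσ : (Equiv.inv (Equiv.Perm (Fin k)) σ).symm = σ := rfl
  rw [hσ]
  congr 1
  rw [eq_iff_iff]
  constructor
  · rintro rfl
    ext r
    simp
  · rintro rfl
    ext r
    simp

theorem symProj_comp_left {d k : ℕ} (a b : Fin k → Fin d) (τ : Equiv.Perm (Fin k)) :
    symProj d k (a ∘ τ) b = symProj d k a b := by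
  rw [symProj_apply, symProj_apply]
  congr 1
  refine Fintype.sum_equiv (Equiv.mulLeft τ) _ _ fun σ => ?_
  congr 1
  rw [eq_iff_iff]
  constructor
  · intro h
    ext r
    have := congrFun h (τ.symm r)
    simp at this
    rw [this]
    rfl
  · rintro rfl
    ext r
    simp [Equiv.Perm.mul_def]

theorem symProj_comp_right {d k : ℕ} (a b : Fin k → Fin d) (τ : Equiv.Perm (Fin k)) :
    symProj d k a (b ∘ τ) = symProj d k a b := by
  rw [symProj_comm, symProj_comp_left, symProj_comm]

theorem star_symProj {d k : ℕ} (a b : Fin k → Fin d) :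
    star (symProj d k a b) = symProj d k a b := by
  rw [symProj_apply]
  simp only [star_mul', star_sum, apply_ite star, star_one, star_zero]
  simp

/-- Each permutation selects exactly one `b`, a rearrangement of `a`, where `v` takes the value `v
a`; the average of `k!` equal terms remains. -/
theorem sum_symProj_mul {d k : ℕ} (a : Fin k → Fin d) (v : (Fin k → Fin d) → ℂ)
    (hv : ∀ (σ : Equiv.Perm (Fin k)) (b : Fin k → Fin d), v (b ∘ σ) = v b) :
    ∑ b, symProj d k a b * v b = v a := by
  have h : ∀ σ : Equiv.Perm (Fin k),
      ∑ b : Fin k → Fin d, (if a = b ∘ σ.symm then v b else 0) = v a := by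
    intro σ
    rw [Finset.sum_eq_single (a ∘ σ)]
    · rw [if_pos (by ext r; simp), hv]
    · intro b _ hb
      rw [if_neg]
      rintro rfl
      exact hb (by ext r; simp)
    · simp
  simp_rw [symProj_apply, mul_assoc, Finset.sum_mul, ite_mul, one_mul, zero_mul]
  rw [← Finset.mul_sum, Finset.sum_comm]
  simp_rw [h]
  simp [Fintype.card_perm, Nat.factorial_ne_zero]

/-- The rows of `Π_k` are themselves symmetric, hence fixed by `Π_k`: this is `Tr Π_k² = Tr Π_k`. -/
theorem sum_symProj_sq {d k : ℕ} :
    ∑ a, ∑ b, symProj d k a b * symProj d k a b = (symProj d k).trace := by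
  refine Finset.sum_congr rfl fun a _ => ?_
  exact sum_symProj_mul a (symProj d k a) fun σ b => symProj_comp_right a b σ

theorem tensorPow_comp {d k : ℕ} (φ : H d) (σ : Equiv.Perm (Fin k)) (a : Fin k → Fin d) :
    tensorPow k φ (a ∘ σ) = tensorPow k φ a :=
  tensorPow_mem k φ σ a

theorem inner_tensorPow {d k : ℕ} (φ ψ : H d) :
    ∑ a, star (tensorPow k φ a) * tensorPow k ψ a = inner ℂ φ ψ ^ k := by
  have : (inner ℂ φ ψ : ℂ) = ∑ i, star (φ i) * ψ i := by
    simp [PiLp.inner_apply, mul_comm]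
  rw [this, ← Fin.prod_const, Finset.prod_univ_sum]
  simp [tensorPow, Finset.prod_mul_distrib]

theorem inner_tensorPow_self {d k : ℕ} {φ : H d} (h : ‖φ‖ = 1) :
    ∑ a, star (tensorPow k φ a) * tensorPow k φ a = 1 := by
  rw [inner_tensorPow, inner_self_eq_norm_sq_to_K, h]
  simp

theorem frobNorm_nonneg {n : Type*} [Fintype n] (A : Matrix n n ℂ) : 0 ≤ frobNorm A :=
  Real.sqrt_nonneg _

theorem frobNorm_sq {n : Type*} [Fintype n] (A : Matrix n n ℂ) :
    frobNorm A ^ 2 = ∑ a, ∑ b, ‖A a b‖ ^ 2 :=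
  Real.sq_sqrt (Finset.sum_nonneg fun _ _ => Finset.sum_nonneg fun _ _ => sq_nonneg _)

theorem ofReal_frobNorm_sq {n : Type*} [Fintype n] (A : Matrix n n ℂ) :
    ((frobNorm A ^ 2 : ℝ) : ℂ) = ∑ a, ∑ b, A a b * star (A a b) := by
  rw [frobNorm_sq]
  push_cast
  refine Finset.sum_congr rfl fun a _ => Finset.sum_congr rfl fun b _ => ?_
  exact (Complex.mul_conj' _).symm

theorem rho_apply {d k : ℕ} (a b : Fin k → Fin d) :
    rho d k a b = 1 / (symProj d k).trace * symProj d k a b := by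
  simp [rho]

theorem star_trace_symProj (d k : ℕ) : star (symProj d k).trace = (symProj d k).trace := by
  simp only [Matrix.trace, star_sum, Matrix.diag_apply, star_symProj]

theorem star_rho {d k : ℕ} (a b : Fin k → Fin d) : star (rho d k a b) = rho d k a b := by
  rw [rho_apply, star_mul', star_symProj, star_div₀, star_trace_symProj, star_one]

/-- The diagonal entries of the symmetric projector. -/
theorem symProj_self_re_pos {d k : ℕ} (a : Fin k → Fin d) : 0 < (symProj d k a a).re := by
  have : symProj d k a a = ((1 / (k.factorial : ℝ) *
      ∑ σ : Equiv.Perm (Fin k), (if a = a ∘ σ.symm then (1 : ℝ) else 0) : ℝ) : ℂ) := by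
    rw [symProj_apply]
    push_cast
    congr 1
    refine Finset.sum_congr rfl fun σ _ => ?_
    split_ifs <;> simp
  rw [this, Complex.ofReal_re]
  refine mul_pos (by positivity) ?_
  refine Finset.sum_pos' (fun σ _ => by positivity) ⟨1, Finset.mem_univ _, ?_⟩
  rw [if_pos (by rfl)]
  exact one_pos

theorem trace_symProj_ne_zero {d k : ℕ} (hd : 0 < d) : (symProj d k).trace ≠ 0 := by
  have : NeZero d := ⟨hd.ne'⟩
  have h : 0 < ((symProj d k).trace).re := by
    rw [Matrix.trace, Complex.re_sum]
    exact Finset.sum_pos (fun a _ => symProj_self_re_pos a) Finset.univ_nonempty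
  intro h0
  simp [h0] at h

/-- A tensor power lies in the symmetric subspace, so `Π_k` acts on it as the identity and only the
normalization of `ρ_k` survives. -/
theorem sum_rho_mul_moment {d k : ℕ} {φ : H d} (h : ‖φ‖ = 1) :
    ∑ a, ∑ b, rho d k a b * moment b a φ = 1 / (symProj d k).trace := by
  simp_rw [rho_apply, moment, mul_assoc]
  simp_rw [← Finset.mul_sum, ← mul_assoc _ _ (star _), ← Finset.sum_mul]
  simp_rw [fun a => sum_symProj_mul a (fun b => tensorPow k φ b) fun σ b => tensorPow_comp φ σ b]
  have := inner_tensorPow_self (k := k) h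
  simp_rw [mul_comm (star _)] at this
  rw [this, mul_one]

theorem star_moment {d k : ℕ} (a b : Fin k → Fin d) (φ : H d) :
    star (moment a b φ) = moment b a φ := by
  simp [moment, mul_comm]

theorem sum_moment_mul_moment {d k : ℕ} (φ ψ : H d) :
    ∑ a : Fin k → Fin d, ∑ b, moment a b φ * moment b a ψ = ((‖inner ℂ φ ψ‖ ^ (2 * k) : ℝ) : ℂ) := by
  have h : ∀ a b : Fin k → Fin d, moment a b φ * moment b a ψ =
      (star (tensorPow k ψ a) * tensorPow k φ a) * (star (tensorPow k φ b) * tensorPow k ψ b) := by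
    intro a b
    simp only [moment]
    ring
  simp_rw [h, ← Finset.mul_sum, ← Finset.sum_mul, inner_tensorPow]
  rw [← mul_pow, pow_mul]
  push_cast
  congr 1
  rw [← Complex.conj_mul' (inner ℂ φ ψ), inner_conj_symm]

theorem sum_frameOp_sq {d k : ℕ} {ι : Type*} [Fintype ι] (χ : Frame d ι) :
    ∑ a, ∑ b, frameOp k χ a b * star (frameOp k χ a b) = (framePotential k χ : ℂ) := by
  have h : ∀ a b : Fin k → Fin d, frameOp k χ a b * star (frameOp k χ a b) =
      1 / (Fintype.card ι : ℂ) ^ 2 *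
        ∑ i, ∑ j, moment a b (χ.vec i) * moment b a (χ.vec j) := by
    intro a b
    rw [frameOp_apply, frameMean, ← Finset.sum_mul_sum]
    simp only [star_mul', star_sum, star_moment, star_div₀, star_one, star_natCast]
    ring
  simp_rw [h]
  simp_rw [← Finset.mul_sum (s := (Finset.univ : Finset (Fin k → Fin d)))]
  rw [framePotential]
  push_cast
  congr 1
  calc _ = ∑ a : Fin k → Fin d, ∑ i, ∑ j, ∑ b, moment a b (χ.vec i) * moment b a (χ.vec j) := by
        refine Finset.sum_congr rfl fun a _ => ?_
        rw [Finset.sum_comm]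
        exact Finset.sum_congr rfl fun i _ => Finset.sum_comm
    _ = ∑ i, ∑ j, ∑ a : Fin k → Fin d, ∑ b, moment a b (χ.vec i) * moment b a (χ.vec j) := by
        rw [Finset.sum_comm]
        exact Finset.sum_congr rfl fun i _ => Finset.sum_comm
    _ = _ := by
        simp_rw [sum_moment_mul_moment]
        push_cast
        rfl

/-- The cross term of the squared distance is the same for all frames, which is why the distance
depends on the frame through its potential alone. -/
theorem sum_rho_mul_frameOp {d k : ℕ} {ι : Type*} [Fintype ι] [Nonempty ι] (χ : Frame d ι) :
    ∑ a, ∑ b, rho d k a b * frameOp k χ b a = 1 / (symProj d k).trace := by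
  simp_rw [frameOp_apply, frameMean, Finset.mul_sum, mul_left_comm (rho d k _ _)]
  have : ∀ a : Fin k → Fin d, ∑ b, ∑ i, 1 / (Fintype.card ι : ℂ) *
      (rho d k a b * moment b a (χ.vec i)) =
      ∑ i, ∑ b, 1 / (Fintype.card ι : ℂ) * (rho d k a b * moment b a (χ.vec i)) :=
    fun a => Finset.sum_comm
  simp_rw [this]
  rw [Finset.sum_comm]
  simp_rw [← Finset.mul_sum, sum_rho_mul_moment (χ.norm_vec _)]
  simp

/-- The squared distance of the frame operator to the Haar moment operator is the excess of the
frame potential over the Welch bound. -/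
theorem frobNorm_frameOp_sub_rho_sq {d k : ℕ} (hd : 0 < d) {ι : Type*} [Fintype ι] [Nonempty ι]
    (χ : Frame d ι) :
    ((frobNorm (frameOp k χ - rho d k) ^ 2 : ℝ) : ℂ) =
      (framePotential k χ : ℂ) - 1 / (symProj d k).trace := by
  have hF : ∀ a b : Fin k → Fin d, star (frameOp k χ a b) = frameOp k χ b a := by
    intro a b
    rw [frameOp_apply, frameOp_apply, frameMean, frameMean]
    simp only [star_mul', star_sum, star_moment, star_div₀, star_one, star_natCast]
  have h : ∀ a b : Fin k → Fin d, (frameOp k χ - rho d k) a b * star ((frameOp k χ - rho d k) a b) =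
      frameOp k χ a b * star (frameOp k χ a b) - rho d k a b * frameOp k χ b a
        - rho d k b a * frameOp k χ a b +
        (1 / (symProj d k).trace) ^ 2 * (symProj d k a b * symProj d k a b) := by
    intro a b
    have h1 : rho d k b a = rho d k a b := by rw [rho_apply, rho_apply, symProj_comm]
    rw [Matrix.sub_apply, star_sub, star_rho, hF, h1, rho_apply]
    ring
  rw [ofReal_frobNorm_sq]
  simp_rw [h, Finset.sum_add_distrib, Finset.sum_sub_distrib, ← Finset.mul_sum]
  rw [sum_frameOp_sq, sum_rho_mul_frameOp, sum_symProj_sq, Finset.sum_comm, sum_rho_mul_frameOp]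
  have := trace_symProj_ne_zero (k := k) hd
  field_simp
  ring

theorem trace_symProj_one (d : ℕ) : (symProj d 1).trace = d := by
  have h : ∀ a : Fin 1 → Fin d, symProj d 1 a a = 1 := by
    intro a
    rw [symProj_apply]
    have hu : ∀ σ : Equiv.Perm (Fin 1), a = a ∘ σ.symm := fun σ => by
      ext r
      exact congrArg (fun s => (a s : ℕ)) (Subsingleton.elim _ _)
    simp [← hu]
  simp [Matrix.trace, h]

theorem trace_symProj_two (d : ℕ) : (symProj d 2).trace = d * (d + 1) / 2 := by
  have hu : (Finset.univ : Finset (Equiv.Perm (Fin 2))) = {1, Equiv.swap 0 1} := by decide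
  have h : ∀ a : Fin 2 → Fin d, symProj d 2 a a = 1 / 2 * (1 + if a 0 = a 1 then 1 else 0) := by
    intro a
    rw [symProj_apply, hu, Finset.sum_pair (by decide)]
    have h1 : a = a ∘ (Equiv.symm (1 : Equiv.Perm (Fin 2))) := rfl
    have h2 : a = a ∘ (Equiv.swap 0 1).symm ↔ a 0 = a 1 := by
      rw [funext_iff, Fin.forall_fin_two]
      simp [eq_comm]
    simp only [if_pos h1, h2]
    simp
  have hdiag : ∑ a : Fin 2 → Fin d, (if a 0 = a 1 then (1 : ℂ) else 0) = d := by
    rw [Fintype.sum_equiv (finTwoArrowEquiv (Fin d)) (fun a => if a 0 = a 1 then (1 : ℂ) else 0)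
      (fun x => if x.1 = x.2 then (1 : ℂ) else 0) (fun a => rfl), Fintype.sum_prod_type]
    simp
  simp only [Matrix.trace, Matrix.diag_apply, h]
  rw [← Finset.mul_sum, Finset.sum_add_distrib, hdiag]
  simp
  ring

/-! ### Gaussian integrals of monomials and the Haar moments -/

/-- The rotation by `π / (m - n)` preserves Lebesgue measure and the Gaussian weight but multiplies
the monomial by `e^{iπ} = -1`. -/
theorem integral_monomial_mul_exp_of_ne {m n : ℕ} (h : m ≠ n) :
    ∫ z : ℂ, z ^ m * star z ^ n * (Real.exp (-‖z‖ ^ 2) : ℂ) = 0 := by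
  set θ : ℝ := Real.pi / ((m : ℝ) - n) with hθ
  have hmn : ((m : ℂ) - n) ≠ 0 := sub_ne_zero.2 (by exact_mod_cast h)
  set u : Circle := Circle.exp θ with hu
  have hu1 : (u : ℂ) ^ m * star (u : ℂ) ^ n = -1 := by
    have h1 : star (u : ℂ) = Complex.exp (-(θ * Complex.I)) := by
      rw [hu, Circle.coe_exp, Complex.star_def, ← Complex.exp_conj]
      simp
    rw [h1, hu, Circle.coe_exp, ← Complex.exp_nat_mul, ← Complex.exp_nat_mul, ← Complex.exp_add,
      ← Complex.exp_pi_mul_I]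
    congr 1
    rw [hθ]
    push_cast
    field_simp
    ring
  have key := (rotation u).measurePreserving.integral_comp
    (rotation u).toHomeomorph.measurableEmbedding
    (fun z : ℂ => z ^ m * star z ^ n * (Real.exp (-‖z‖ ^ 2) : ℂ))
  have h2 : ∀ z : ℂ, (rotation u z) ^ m * star (rotation u z) ^ n *
      (Real.exp (-‖rotation u z‖ ^ 2) : ℂ) =
      - (z ^ m * star z ^ n * (Real.exp (-‖z‖ ^ 2) : ℂ)) := by
    intro z
    rw [LinearIsometryEquiv.norm_map, rotation_apply, star_mul', mul_pow, mul_pow]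
    linear_combination (z ^ m * star z ^ n * (Real.exp (-‖z‖ ^ 2) : ℂ)) * hu1
  simp_rw [h2, integral_neg] at key
  exact self_eq_neg.1 key.symm

theorem integral_monomial_mul_exp_self (m : ℕ) :
    ∫ z : ℂ, z ^ m * star z ^ m * (Real.exp (-‖z‖ ^ 2) : ℂ) = Real.pi * m.factorial := by
  have h := Complex.integral_rpow_mul_exp_neg_rpow (p := 2) (q := 2 * m) (by norm_num)
    (by have : (0 : ℝ) ≤ m := m.cast_nonneg
        linarith)
  have h1 : ∀ z : ℂ, z ^ m * star z ^ m * (Real.exp (-‖z‖ ^ 2) : ℂ) =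
      ((‖z‖ ^ (2 * (m : ℝ)) * Real.exp (-‖z‖ ^ (2 : ℝ)) : ℝ) : ℂ) := by
    intro z
    rw [← mul_pow, Complex.star_def, Complex.mul_conj']
    have : ‖z‖ ^ (2 * (m : ℝ)) = (‖z‖ ^ 2) ^ m := by
      rw [← pow_mul, ← Real.rpow_natCast]
      push_cast
      rfl
    rw [this, Real.rpow_two]
    push_cast
    rfl
  simp_rw [h1]
  rw [integral_complex_ofReal, h]
  have h2 : (2 * (m : ℝ) + 2) / 2 = m + 1 := by ring
  rw [h2, Real.Gamma_nat_eq_factorial]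
  push_cast
  ring

theorem integral_monomial_mul_exp (m n : ℕ) :
    ∫ z : ℂ, z ^ m * star z ^ n * (Real.exp (-‖z‖ ^ 2) : ℂ) =
      Real.pi * if m = n then (m.factorial : ℂ) else 0 := by
  split_ifs with h
  · subst h
    exact integral_monomial_mul_exp_self m
  · rw [integral_monomial_mul_exp_of_ne h, mul_zero]

theorem tensorPow_eq_prod_pow {d k : ℕ} (a : Fin k → Fin d) (φ : H d) :
    tensorPow k φ a = ∏ i, φ i ^ Fintype.card {r // a r = i} := by
  change ∏ r, φ (a r) = _
  rw [← Finset.prod_fiberwise Finset.univ a]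
  refine Finset.prod_congr rfl fun i _ => ?_
  rw [Fintype.card_subtype, ← Finset.prod_const]
  exact Finset.prod_congr rfl fun r hr => by rw [(Finset.mem_filter.1 hr).2]

instance isAddHaarMeasure_lebesgue (d : ℕ) : (lebesgue d).IsAddHaarMeasure :=
  (PiLp.continuousLinearEquiv 2 ℝ (fun _ : Fin d => ℂ)).symm.isAddHaarMeasure_map volume

theorem integral_moment_mul_exp {d k : ℕ} (a b : Fin k → Fin d) :
    ∫ x, moment a b x * (Real.exp (-‖x‖ ^ 2) : ℂ) ∂(lebesgue d) =
      ∏ i, ((Real.pi : ℂ) * if Fintype.card {r // a r = i} = Fintype.card {r // b r = i} then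
        ((Fintype.card {r // a r = i}).factorial : ℂ) else 0) := by
  have hm : lebesgue d = (volume : Measure (Fin d → ℂ)).map (MeasurableEquiv.toLp 2 (Fin d → ℂ)) :=
    rfl
  rw [hm, integral_map_equiv]
  simp_rw [← integral_monomial_mul_exp]
  rw [← integral_fintype_prod_volume_eq_prod]
  congr 1
  ext x
  rw [moment, tensorPow_eq_prod_pow, tensorPow_eq_prod_pow, star_prod, EuclideanSpace.norm_sq_eq,
    ← Finset.sum_neg_distrib, Real.exp_sum, Complex.ofReal_prod, ← Finset.prod_mul_distrib,
    ← Finset.prod_mul_distrib]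
  simp

/-- The permutations carrying `b` to `a` exist only when all fibre sizes agree; they then form a
coset of the stabilizer of `b`, whose order is the product of the factorials of the fibre sizes. The
same product comes out of the Gaussian integral. -/
theorem symProj_eq_prod {d k : ℕ} (a b : Fin k → Fin d) :
    symProj d k a b = 1 / (k.factorial : ℂ) *
      ∏ i, if Fintype.card {r // a r = i} = Fintype.card {r // b r = i} then
        ((Fintype.card {r // a r = i}).factorial : ℂ) else 0 := by
  by_cases h : ∀ i, Fintype.card {r // a r = i} = Fintype.card {r // b r = i}
  · let τ : Equiv.Perm (Fin k) := Equiv.ofFiberEquiv fun i => Fintype.equivOfCardEq (h i)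
    have hτ : a = b ∘ τ := by
      ext r
      exact congrArg Fin.val (Equiv.ofFiberEquiv_map (fun i => Fintype.equivOfCardEq (h i)) r).symm
    simp_rw [if_pos (h _)]
    rw [hτ, symProj_comp_left, symProj_apply, ← hτ]
    congr 1
    have := DomMulAct.stabilizer_card b
    simp_rw [h]
    rw [← Nat.cast_prod, ← this, Finset.sum_boole, Fintype.card_subtype]
    congr 1
    refine Finset.card_equiv (Equiv.inv _) fun σ => ?_
    simp only [Finset.mem_filter, Finset.mem_univ, true_and]
    exact eq_comm
  · push Not at h
    obtain ⟨i, hi⟩ := h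
    rw [Finset.prod_eq_zero (Finset.mem_univ i) (if_neg hi), symProj_apply,
      Finset.sum_eq_zero]
    intro σ _
    rw [if_neg]
    rintro rfl
    exact hi (Fintype.card_congr (Equiv.subtypeEquiv σ.symm fun r => Iff.rfl))

theorem integral_moment_mul_exp_eq_symProj {d k : ℕ} (a b : Fin k → Fin d) :
    ∫ x, moment a b x * (Real.exp (-‖x‖ ^ 2) : ℂ) ∂(lebesgue d) =
      (Real.pi : ℂ) ^ d * k.factorial * symProj d k a b := by
  rw [integral_moment_mul_exp, symProj_eq_prod, Finset.prod_mul_distrib]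
  have : (k.factorial : ℂ) ≠ 0 := by exact_mod_cast k.factorial_ne_zero
  simp only [Finset.prod_const, Finset.card_univ, Fintype.card_fin]
  field_simp

theorem moment_smul {d k : ℕ} (a b : Fin k → Fin d) (r : ℝ) (φ : H d) :
    moment a b (r • φ) = (r : ℂ) ^ (2 * k) * moment a b φ := by
  simp only [moment, tensorPow, PiLp.smul_apply, Complex.real_smul, Finset.prod_mul_distrib,
    Finset.prod_const, Finset.card_univ, Fintype.card_fin, star_mul', star_pow, Complex.star_def,
    Complex.conj_ofReal]
  ring

/-- Polar coordinates: the Gaussian integral of a monomial is a universal multiple of its integral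
over the unit sphere. -/
theorem exists_integral_moment_mul_exp_eq (d k : ℕ) (hd : 0 < d) :
    ∃ R : ℂ, ∀ a b : Fin k → Fin d,
      ∫ x, moment a b x * (Real.exp (-‖x‖ ^ 2) : ℂ) ∂(lebesgue d) =
        (∫ φ : Metric.sphere (0 : H d) 1, moment a b φ ∂(lebesgue d).toSphere) * R := by
  have : NeZero d := ⟨hd.ne'⟩
  -- `R` is the radial integral. Only its independence of `a` and `b` matters; it is never
  -- evaluated.
  refine ⟨∫ r : Set.Ioi (0 : ℝ), (r : ℂ) ^ (2 * k) * (Real.exp (-(r : ℝ) ^ 2) : ℂ)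
    ∂(Measure.volumeIoiPow (Module.finrank ℝ (H d) - 1)), fun a b => ?_⟩
  have hs : MeasurableSet ({(0 : H d)}ᶜ : Set (H d)) := (measurableSet_singleton _).compl
  rw [← integral_prod_mul, ← (lebesgue d).measurePreserving_homeomorphUnitSphereProd.integral_comp
    (Homeomorph.measurableEmbedding _)]
  -- The polar homeomorphism lives on the complement of the origin, which is a null set.
  conv_lhs => rw [← restrict_compl_singleton (μ := lebesgue d) 0, ← integral_subtype_comap hs]
  congr 1
  ext x
  have hx : ‖(x : H d)‖ ≠ 0 := norm_ne_zero_iff.2 x.2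
  rw [homeomorphUnitSphereProd_apply_snd_coe, homeomorphUnitSphereProd_apply_fst_coe, ← mul_assoc,
    mul_comm (moment _ _ (_ • _)), ← moment_smul, smul_inv_smul₀ hx]

theorem continuous_moment {d k : ℕ} (a b : Fin k → Fin d) : Continuous (moment a b) := by
  unfold moment tensorPow
  fun_prop

theorem integrable_moment {d k : ℕ} (a b : Fin k → Fin d) :
    Integrable (fun φ : Metric.sphere (0 : H d) 1 => moment a b (φ : H d))
      (lebesgue d).toSphere :=
  ((continuous_moment a b).comp continuous_subtype_val).integrable_of_hasCompactSupport
    (HasCompactSupport.of_compactSpace _)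

theorem sum_moment_self {d k : ℕ} {φ : H d} (h : ‖φ‖ = 1) :
    ∑ a : Fin k → Fin d, moment a a φ = 1 := by
  rw [← inner_tensorPow_self (k := k) h]
  exact Finset.sum_congr rfl fun a _ => mul_comm _ _

/-- The Haar moments of pure states. -/
theorem haarMean_moment {d k : ℕ} (hd : 0 < d) (a b : Fin k → Fin d) :
    haarMean (moment a b) = rho d k a b := by
  have : NeZero d := ⟨hd.ne'⟩
  obtain ⟨R, hR⟩ := exists_integral_moment_mul_exp_eq d k hd
  simp_rw [integral_moment_mul_exp_eq_symProj] at hR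
  set K : ℂ := (Real.pi : ℂ) ^ d * k.factorial with hK
  have hK0 : K ≠ 0 := mul_ne_zero (pow_ne_zero _ (by exact_mod_cast Real.pi_ne_zero))
    (by exact_mod_cast k.factorial_ne_zero)
  set S : ℂ := ((lebesgue d).toSphere.real Set.univ : ℂ) with hS
  -- The diagonal moments sum to `1` on the sphere, so the trace determines the product of sphere
  -- area and radial integral, and shows that neither vanishes.
  have htr : K * (symProj d k).trace = S * R := by
    rw [Matrix.trace, Finset.mul_sum]
    simp_rw [Matrix.diag_apply, hR]
    rw [← Finset.sum_mul, ← integral_finsetSum _ fun a _ => integrable_moment a a]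
    have h1 : ∀ φ : Metric.sphere (0 : H d) 1,
        ∑ a : Fin k → Fin d, moment a a (φ : H d) = 1 := fun φ => sum_moment_self (by simp)
    simp_rw [h1]
    simp [hS]
  have ht := trace_symProj_ne_zero (k := k) hd
  have hSR : S * R ≠ 0 := htr ▸ mul_ne_zero hK0 ht
  have hS0 : S ≠ 0 := left_ne_zero_of_mul hSR
  rw [haarMean, average_eq, rho_apply, Complex.real_smul, Complex.ofReal_inv]
  have h2 := hR a b
  rw [← hS]
  field_simp
  apply mul_left_cancel₀ hK0
  apply mul_right_cancel₀ (right_ne_zero_of_mul hSR)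
  linear_combination (symProj d k).trace * -K * h2 + K * symProj d k a b * htr

/-! ### Normalized second moments of symmetric random matrices -/

section SymmetricEnsemble

variable {n : Type*} [Fintype n]

theorem measurePreserving_pi_pi_sign [DecidableEq n] {ν : Measure ℂ} [IsProbabilityMeasure ν]
    (hν : MeasurePreserving (fun z : ℂ => -z) ν ν) (p : n × n) :
    MeasurePreserving (fun (X : n → n → ℂ) i j => if (i, j) = p then -X i j else X i j)
      (Measure.pi fun _ => Measure.pi fun _ => ν) (Measure.pi fun _ => Measure.pi fun _ => ν) := by
  refine measurePreserving_pi (fun _ => Measure.pi fun _ => ν) (fun _ => Measure.pi fun _ => ν)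
    (f := fun i x j => if (i, j) = p then -x j else x j) fun i => ?_
  refine measurePreserving_pi (fun _ => ν) (fun _ => ν)
    (f := fun j z => if (i, j) = p then -z else z) fun j => ?_
  split_ifs
  · exact hν
  · exact MeasurePreserving.id ν

theorem measurePreserving_pi_perm {α : Type*} [MeasurableSpace α] (μ : Measure α)
    [SigmaFinite μ] (σ : Equiv.Perm n) :
    MeasurePreserving (fun (x : n → α) i => x (σ i)) (Measure.pi fun _ => μ)
      (Measure.pi fun _ => μ) := by
  have h := measurePreserving_piCongrLeft (fun _ : n => μ) σ.symm
  convert h using 1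
  ext x i
  have := MeasurableEquiv.piCongrLeft_apply_apply (β := fun _ : n => α) σ.symm x (σ i)
  simpa using this.symm

theorem measurePreserving_pi_pi_perm (ν : Measure ℂ) [IsProbabilityMeasure ν]
    (σ τ : Equiv.Perm n) :
    MeasurePreserving (fun (X : n → n → ℂ) i j => X (σ i) (τ j))
      (Measure.pi fun _ => Measure.pi fun _ => ν) (Measure.pi fun _ => Measure.pi fun _ => ν) :=
  (measurePreserving_pi _ _ fun _ => measurePreserving_pi_perm ν τ).comp
    (measurePreserving_pi_perm (Measure.pi fun _ : n => ν) σ)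

/-- The normalized product of two matrix entries. -/
def normalizedPair (p q : n × n) (X : n → n → ℂ) : ℂ :=
  ((∑ i, ∑ j, ‖X i j‖ ^ 2 : ℝ) : ℂ)⁻¹ * (X p.1 p.2 * star (X q.1 q.2))

theorem norm_sq_entry_le (p : n × n) (X : n → n → ℂ) :
    ‖X p.1 p.2‖ ^ 2 ≤ ∑ i, ∑ j, ‖X i j‖ ^ 2 := by
  rw [← Fintype.sum_prod_type' (fun i j => ‖X i j‖ ^ 2)]
  exact Finset.single_le_sum (f := fun p : n × n => ‖X p.1 p.2‖ ^ 2)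
    (fun _ _ => sq_nonneg _) (Finset.mem_univ p)

/-- Normalization bounds the integrand, so integrability needs no moment assumption on the entries.
At `X = 0` the inverse is `0` by convention and the bound persists. -/
theorem norm_normalizedPair_le_one (p q : n × n) (X : n → n → ℂ) :
    ‖normalizedPair p q X‖ ≤ 1 := by
  have hp := norm_sq_entry_le p X
  have hq := norm_sq_entry_le q X
  have h0 : 0 ≤ ∑ i, ∑ j, ‖X i j‖ ^ 2 := (sq_nonneg _).trans hp
  rw [normalizedPair, norm_mul, norm_inv, norm_mul, norm_star, Complex.norm_real,
    Real.norm_of_nonneg h0]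
  refine inv_mul_le_one_of_le₀ ?_ h0
  nlinarith [sq_nonneg (‖X p.1 p.2‖ - ‖X q.1 q.2‖)]

theorem integrable_normalizedPair (p q : n × n) (μ : Measure (n → n → ℂ)) [IsFiniteMeasure μ] :
    Integrable (normalizedPair p q) μ := by
  refine Integrable.of_bound (C := 1) (Measurable.aestronglyMeasurable ?_)
    (Filter.Eventually.of_forall (norm_normalizedPair_le_one p q))
  unfold normalizedPair
  fun_prop

/-- Flipping the sign of the entry at `p` preserves the law and the norm but negates the pair. -/
theorem integral_normalizedPair_of_ne {ν : Measure ℂ} [IsProbabilityMeasure ν]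
    (hν : MeasurePreserving (fun z : ℂ => -z) ν ν) {p q : n × n} (hpq : p ≠ q) :
    ∫ X, normalizedPair p q X ∂(Measure.pi fun _ => Measure.pi fun _ => ν) = 0 := by
  classical
  have hT := measurePreserving_pi_pi_sign hν p
  have h := integral_map (φ := fun (X : n → n → ℂ) i j => if (i, j) = p then -X i j else X i j)
    hT.aemeasurable (f := normalizedPair p q)
    (by rw [hT.map_eq]; exact (integrable_normalizedPair p q _).aestronglyMeasurable)
  rw [hT.map_eq] at h
  have h2 : ∀ X : n → n → ℂ,
      normalizedPair p q (fun i j => if (i, j) = p then -X i j else X i j) =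
        -normalizedPair p q X := by
    intro X
    have h3 : ∀ i j, ‖if (i, j) = p then -X i j else X i j‖ = ‖X i j‖ := by
      intro i j
      split_ifs <;> simp
    simp only [normalizedPair, h3, Prod.mk.eta, if_true, if_neg hpq.symm]
    ring
  simp_rw [h2, integral_neg] at h
  exact self_eq_neg.1 h

/-- Swapping one pair of rows and one pair of columns preserves the law and moves the entry at `q`
to position `p`. -/
theorem integral_normalizedPair_self (ν : Measure ℂ) [IsProbabilityMeasure ν] (p q : n × n) :
    ∫ X, normalizedPair p p X ∂(Measure.pi fun _ => Measure.pi fun _ => ν) =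
      ∫ X, normalizedPair q q X ∂(Measure.pi fun _ => Measure.pi fun _ => ν) := by
  classical
  have hT := measurePreserving_pi_pi_perm ν (Equiv.swap p.1 q.1) (Equiv.swap p.2 q.2)
  have h := integral_map
    (φ := fun (X : n → n → ℂ) i j => X (Equiv.swap p.1 q.1 i) (Equiv.swap p.2 q.2 j))
    hT.aemeasurable (f := normalizedPair p p)
    (by rw [hT.map_eq]; exact (integrable_normalizedPair p p _).aestronglyMeasurable)
  rw [hT.map_eq] at h
  rw [h]
  congr 1
  ext X
  have h3 : ∑ i, ∑ j, ‖X (Equiv.swap p.1 q.1 i) (Equiv.swap p.2 q.2 j)‖ ^ 2 =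
      ∑ i, ∑ j, ‖X i j‖ ^ 2 := by
    rw [Equiv.sum_comp (Equiv.swap p.1 q.1) fun i => ∑ j, ‖X i (Equiv.swap p.2 q.2 j)‖ ^ 2]
    exact Finset.sum_congr rfl fun i _ =>
      Equiv.sum_comp (Equiv.swap p.2 q.2) fun j => ‖X i j‖ ^ 2
  simp only [normalizedPair, h3, Equiv.swap_apply_left]

/-- The normalized second moment of a linear form in the entries of a random matrix with
independent symmetric identically distributed entries is a universal multiple of the squared norm
of its coefficients. -/
theorem exists_integral_normalized_linearForm {ν : Measure ℂ} [IsProbabilityMeasure ν]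
    (hν : MeasurePreserving (fun z : ℂ => -z) ν ν) :
    ∃ C : ℝ, 0 ≤ C ∧ ∀ A : n → n → ℂ,
      ∫ X : n → n → ℂ, (∑ i, ∑ j, ‖X i j‖ ^ 2)⁻¹ * ‖∑ i, ∑ j, X i j * A i j‖ ^ 2
        ∂(Measure.pi fun _ => Measure.pi fun _ => ν) = C * ∑ i, ∑ j, ‖A i j‖ ^ 2 := by
  classical
  rcases isEmpty_or_nonempty n with hn | ⟨⟨i₀⟩⟩
  · exact ⟨0, le_rfl, fun A => by simp⟩
  set μ : Measure (n → n → ℂ) := Measure.pi fun _ => Measure.pi fun _ => ν with hμ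
  set p₀ : n × n := (i₀, i₀)
  have hC : ((∫ X : n → n → ℂ, (∑ i, ∑ j, ‖X i j‖ ^ 2)⁻¹ * ‖X p₀.1 p₀.2‖ ^ 2 ∂μ : ℝ) : ℂ) =
      ∫ X, normalizedPair p₀ p₀ X ∂μ := by
    rw [← integral_complex_ofReal]
    congr 1
    ext X
    rw [normalizedPair, Complex.star_def, Complex.mul_conj']
    push_cast
    rfl
  refine ⟨∫ X : n → n → ℂ, (∑ i, ∑ j, ‖X i j‖ ^ 2)⁻¹ * ‖X p₀.1 p₀.2‖ ^ 2 ∂μ,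
    integral_nonneg fun X => by positivity, fun A => ?_⟩
  apply Complex.ofReal_injective
  rw [Complex.ofReal_mul, hC, ← integral_complex_ofReal]
  -- The square expands into normalized pairs; after integration only the terms with `p = q`
  -- survive, all with the same weight.
  have h1 : ∀ X : n → n → ℂ,
      (((∑ i, ∑ j, ‖X i j‖ ^ 2)⁻¹ * ‖∑ i, ∑ j, X i j * A i j‖ ^ 2 : ℝ) : ℂ) =
        ∑ p : n × n, ∑ q : n × n, (A p.1 p.2 * star (A q.1 q.2)) * normalizedPair p q X := by
    intro X
    rw [← Fintype.sum_prod_type' (fun i j => X i j * A i j), Complex.ofReal_mul,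
      Complex.ofReal_pow, ← Complex.mul_conj', map_sum, Finset.sum_mul_sum, Finset.mul_sum]
    refine Finset.sum_congr rfl fun p _ => ?_
    rw [Finset.mul_sum]
    refine Finset.sum_congr rfl fun q _ => ?_
    rw [normalizedPair, Complex.ofReal_inv, map_mul, Complex.star_def]
    ring
  simp_rw [h1]
  rw [integral_finsetSum _ fun p _ => integrable_finsetSum _ fun q _ =>
    (integrable_normalizedPair p q μ).const_mul _]
  have h2 : ∀ p : n × n, ∫ X, ∑ q : n × n,
      (A p.1 p.2 * star (A q.1 q.2)) * normalizedPair p q X ∂μ =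
        (∫ X, normalizedPair p₀ p₀ X ∂μ) * ((‖A p.1 p.2‖ ^ 2 : ℝ) : ℂ) := by
    intro p
    rw [integral_finsetSum _ fun q _ => (integrable_normalizedPair p q μ).const_mul _,
      Finset.sum_eq_single p]
    · rw [integral_const_mul, integral_normalizedPair_self ν p p₀, Complex.star_def,
        Complex.mul_conj']
      push_cast
      ring
    · intro q _ hq
      rw [integral_const_mul, integral_normalizedPair_of_ne hν hq.symm, mul_zero]
    · simp
  simp_rw [h2]
  rw [← Finset.mul_sum, ← Fintype.sum_prod_type' (fun i j => ‖A i j‖ ^ 2)]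
  push_cast
  rfl

end SymmetricEnsemble

theorem measurable_complex_mk : Measurable fun z : ℝ × ℝ => (⟨z.1, z.2⟩ : ℂ) :=
  Complex.measurableEquivRealProd.symm.measurable

instance isProbabilityMeasure_complexGaussian : IsProbabilityMeasure complexGaussian :=
  Measure.isProbabilityMeasure_map measurable_complex_mk.aemeasurable

theorem measurePreserving_neg_complexGaussian :
    MeasurePreserving (fun z : ℂ => -z) complexGaussian complexGaussian := by
  refine ⟨measurable_neg, ?_⟩
  have hg : MeasurePreserving (fun x : ℝ => -x) (ProbabilityTheory.gaussianReal 0 (1 / 2))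
      (ProbabilityTheory.gaussianReal 0 (1 / 2)) :=
    ⟨measurable_neg, by rw [ProbabilityTheory.gaussianReal_map_neg, neg_zero]⟩
  have hp := hg.prod hg
  rw [complexGaussian, Measure.map_map measurable_neg measurable_complex_mk]
  conv_rhs => rw [← hp.map_eq, Measure.map_map measurable_complex_mk hp.measurable]
  rfl

/-! ### Operators on the symmetric subspace in coordinates -/

section SymmetricSubspace

variable {d k : ℕ}

/-- The matrix entry `|e_j⟩⟨e_i|` paired with a matrix on the tensor power. -/
def symPairing (D : Matrix (Fin k → Fin d) (Fin k → Fin d) ℂ)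
    (i j : Fin (Module.finrank ℂ (symSubspace d k))) : ℂ :=
  ∑ a, ∑ b, star ((symBasis d k j : EuclideanSpace ℂ (Fin k → Fin d)) a) *
    (symBasis d k i : EuclideanSpace ℂ (Fin k → Fin d)) b * D a b

/-- This is Parseval in the symmetric subspace; the symmetry of `w` ensures that nothing is lost by
using only a basis of that subspace. -/
theorem sum_norm_sq_symBasis (w : (Fin k → Fin d) → ℂ)
    (hw : ∀ (σ : Equiv.Perm (Fin k)) (a : Fin k → Fin d), w (a ∘ σ) = w a) :
    ∑ j, ‖∑ a, star ((symBasis d k j : EuclideanSpace ℂ (Fin k → Fin d)) a) * w a‖ ^ 2 =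
      ∑ a, ‖w a‖ ^ 2 := by
  let v : symSubspace d k := ⟨WithLp.toLp 2 w, fun σ a => hw σ a⟩
  have h := (symBasis d k).sum_sq_norm_inner_right v
  have hv : ‖v‖ ^ 2 = ∑ a, ‖w a‖ ^ 2 := EuclideanSpace.norm_sq_eq _
  rw [← hv, ← h]
  refine Finset.sum_congr rfl fun j _ => ?_
  congr 2
  rw [Submodule.coe_inner, PiLp.inner_apply]
  exact Finset.sum_congr rfl fun a _ => mul_comm _ _

/-- Parseval is applied once per tensor index: `hl` permits it in `a`, `hr` in `b`. It turns the
norm of the coefficients of the linear form in `X` into a Hilbert–Schmidt norm. -/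
theorem sum_norm_sq_symPairing (D : Matrix (Fin k → Fin d) (Fin k → Fin d) ℂ)
    (hl : ∀ (σ : Equiv.Perm (Fin k)) (a b : Fin k → Fin d), D (a ∘ σ) b = D a b)
    (hr : ∀ (σ : Equiv.Perm (Fin k)) (a b : Fin k → Fin d), D a (b ∘ σ) = D a b) :
    ∑ i, ∑ j, ‖symPairing D i j‖ ^ 2 = ∑ a, ∑ b, ‖D a b‖ ^ 2 := by
  have h1 : ∀ i, ∑ j, ‖symPairing D i j‖ ^ 2 =
      ∑ a, ‖∑ b, (symBasis d k i : EuclideanSpace ℂ (Fin k → Fin d)) b * D a b‖ ^ 2 := by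
    intro i
    rw [← sum_norm_sq_symBasis
      (fun a => ∑ b, (symBasis d k i : EuclideanSpace ℂ (Fin k → Fin d)) b * D a b)
      fun σ a => by simp only [hl]]
    simp only [symPairing, Finset.mul_sum, mul_assoc]
  simp_rw [h1]
  rw [Finset.sum_comm]
  refine Finset.sum_congr rfl fun a _ => ?_
  -- Conjugating the row compensates for the basis vector `i` entering the pairing without a
  -- conjugate.
  have h2 := sum_norm_sq_symBasis (fun b => star (D a b)) fun σ b => by simp only [hr]
  simp only [norm_star] at h2
  rw [← h2]
  refine Finset.sum_congr rfl fun i _ => ?_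
  rw [← norm_star, star_sum]
  simp only [star_mul', mul_comm]

theorem hsNorm_opOfMatrix_sq (X : Fin (Module.finrank ℂ (symSubspace d k)) →
      Fin (Module.finrank ℂ (symSubspace d k)) → ℂ) :
    hsNorm (opOfMatrix d k X) ^ 2 = ∑ i, ∑ j, ‖X i j‖ ^ 2 := by
  rw [hsNorm, Real.sq_sqrt (Finset.sum_nonneg fun _ _ => sq_nonneg _), Finset.sum_comm]
  refine Finset.sum_congr rfl fun j _ => ?_
  rw [← (symBasis d k).sum_sq_norm_inner_right]
  refine Finset.sum_congr rfl fun i _ => ?_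
  congr 2
  have h := Matrix.toLin_self (symBasis d k).toBasis (symBasis d k).toBasis (Matrix.of X) j
  simp only [OrthonormalBasis.coe_toBasis] at h
  rw [opOfMatrix, h, (symBasis d k).orthonormal.inner_right_fintype]
  rfl

theorem symPoly_opOfMatrix (X : Fin (Module.finrank ℂ (symSubspace d k)) →
      Fin (Module.finrank ℂ (symSubspace d k)) → ℂ) (φ : H d) :
    symPoly (opOfMatrix d k X) φ =
      ∑ i, ∑ j, X i j * symPairing (Matrix.of fun a b => moment a b φ) i j := by
  have hM : ∀ j, opOfMatrix d k X (symBasis d k j) = ∑ i, X i j • symBasis d k i := by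
    intro j
    have h := Matrix.toLin_self (symBasis d k).toBasis (symBasis d k).toBasis (Matrix.of X) j
    simp only [OrthonormalBasis.coe_toBasis] at h
    rw [opOfMatrix, h]
    rfl
  have hv : symPow k φ = ∑ j, (inner ℂ (symBasis d k j) (symPow k φ) : ℂ) • symBasis d k j :=
    ((symBasis d k).sum_repr' _).symm
  have hMv : opOfMatrix d k X (symPow k φ) =
      ∑ j, (inner ℂ (symBasis d k j) (symPow k φ) : ℂ) • ∑ i, X i j • symBasis d k i := by
    conv_lhs => rw [hv]
    simp only [map_sum, map_smul, hM]
  rw [symPoly, hMv]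
  rw [Submodule.coe_inner]
  simp only [Submodule.coe_sum, Submodule.coe_smul, inner_sum, inner_smul_right, Finset.mul_sum]
  rw [Finset.sum_comm]
  refine Finset.sum_congr rfl fun i _ => Finset.sum_congr rfl fun j _ => ?_
  rw [mul_left_comm]
  congr 1
  rw [Submodule.coe_inner, PiLp.inner_apply, PiLp.inner_apply,
    Finset.sum_mul_sum, symPairing]
  refine Finset.sum_congr rfl fun a _ => Finset.sum_congr rfl fun b _ => ?_
  simp only [symPow, moment, Matrix.of_apply, RCLike.inner_apply, Complex.star_def]
  ring

end SymmetricSubspace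

/-! ### Haar and frame averages of combinations of moments -/

variable {d k : ℕ}

theorem haarMean_sum_moment (hd : 0 < d) {T : Type*} (s : Finset T) (c : T → ℂ)
    (a b : T → Fin k → Fin d) :
    haarMean (fun φ : H d => ∑ t ∈ s, c t * moment (a t) (b t) φ) =
      ∑ t ∈ s, c t * rho d k (a t) (b t) := by
  simp_rw [← haarMean_moment hd, haarMean, average_eq]
  rw [integral_finsetSum _ fun t _ => (integrable_moment (a t) (b t)).const_mul _,
    Finset.smul_sum]
  refine Finset.sum_congr rfl fun t _ => ?_
  rw [integral_const_mul, mul_smul_comm]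

theorem frameMean_sum_moment {ι : Type*} [Fintype ι] (χ : Frame d ι) {T : Type*} (s : Finset T)
    (c : T → ℂ) (a b : T → Fin k → Fin d) :
    frameMean χ (fun φ : H d => ∑ t ∈ s, c t * moment (a t) (b t) φ) =
      ∑ t ∈ s, c t * frameOp k χ (a t) (b t) := by
  simp_rw [frameOp_apply, frameMean]
  rw [Finset.sum_comm]
  simp_rw [← Finset.mul_sum, Finset.mul_sum, mul_left_comm]

theorem haarMean_congr {f g : H d → ℂ} (h : ∀ φ, ‖φ‖ = 1 → f φ = g φ) :
    haarMean f = haarMean g := by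
  unfold haarMean
  congr 1
  ext φ
  exact h φ (by simp)

theorem frameMean_congr {ι : Type*} [Fintype ι] (χ : Frame d ι) {f g : H d → ℂ}
    (h : ∀ φ, ‖φ‖ = 1 → f φ = g φ) : frameMean χ f = frameMean χ g := by
  unfold frameMean
  congr 1
  exact Finset.sum_congr rfl fun i _ => h _ (χ.norm_vec i)

/-! ### The average error -/

/-- The Haar and frame averages of a moment are entries of `ρ_k` and `𝓕_k`, so the error of `p_M` is
one linear form in `X` with coefficients from `ρ_k - 𝓕_k`. -/
theorem avgError_eq (hd : 0 < d) {ι : Type*} [Fintype ι] (χ : Frame d ι) :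
    avgError k χ = Real.sqrt (∫ X, (∑ i, ∑ j, ‖X i j‖ ^ 2)⁻¹ *
      ‖∑ i, ∑ j, X i j * symPairing (rho d k - frameOp k χ) i j‖ ^ 2
      ∂(ginibre (Fin (Module.finrank ℂ (symSubspace d k))))) := by
  rw [avgError]
  congr 2
  ext X
  rw [hsNorm_opOfMatrix_sq]
  congr 3
  let c : (Fin k → Fin d) × (Fin k → Fin d) → ℂ := fun p => ∑ i, ∑ j, X i j *
    (star ((symBasis d k j : EuclideanSpace ℂ (Fin k → Fin d)) p.1) *
      (symBasis d k i : EuclideanSpace ℂ (Fin k → Fin d)) p.2)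
  have hD : ∀ D : Matrix (Fin k → Fin d) (Fin k → Fin d) ℂ,
      ∑ i, ∑ j, X i j * symPairing D i j = ∑ p, c p * D p.1 p.2 := by
    intro D
    symm
    simp_rw [c, Finset.sum_mul]
    rw [Finset.sum_comm]
    refine Finset.sum_congr rfl fun i _ => ?_
    rw [Finset.sum_comm]
    refine Finset.sum_congr rfl fun j _ => ?_
    rw [Fintype.sum_prod_type, symPairing, Finset.mul_sum]
    refine Finset.sum_congr rfl fun a _ => ?_
    rw [Finset.mul_sum]
    exact Finset.sum_congr rfl fun b _ => mul_assoc _ _ _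
  have hp : symPoly (opOfMatrix d k X) = fun φ => ∑ p, c p * moment p.1 p.2 φ := by
    ext φ
    rw [symPoly_opOfMatrix, hD]
    rfl
  rw [hp, hD, haarMean_sum_moment hd, frameMean_sum_moment, ← Finset.sum_sub_distrib]
  refine Finset.sum_congr rfl fun p _ => ?_
  rw [Matrix.sub_apply, mul_sub]

theorem sum_norm_sq_symPairing_rho_sub_frameOp {ι : Type*} [Fintype ι] (χ : Frame d ι) :
    ∑ i, ∑ j, ‖symPairing (rho d k - frameOp k χ) i j‖ ^ 2 =
      frobNorm (frameOp k χ - rho d k) ^ 2 := by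
  rw [sum_norm_sq_symPairing, frobNorm_sq]
  · refine Finset.sum_congr rfl fun a _ => Finset.sum_congr rfl fun b _ => ?_
    rw [Matrix.sub_apply, Matrix.sub_apply, norm_sub_rev]
  · intro σ a b
    simp only [Matrix.sub_apply, frameOp_apply, rho_apply, symProj_comp_left, frameMean, moment,
      tensorPow_comp]
  · intro σ a b
    simp only [Matrix.sub_apply, frameOp_apply, rho_apply, symProj_comp_right, frameMean, moment,
      tensorPow_comp]

/-- The average error is a monotone function of the Hilbert-Schmidt distance. -/
theorem avgError_le_avgError (hd : 0 < d) {ι κ : Type*} [Fintype ι] [Fintype κ]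
    (χ : Frame d ι) (χ' : Frame d κ)
    (h : frobNorm (frameOp k χ - rho d k) ≤ frobNorm (frameOp k χ' - rho d k)) :
    avgError k χ ≤ avgError k χ' := by
  obtain ⟨C, hC, hA⟩ := exists_integral_normalized_linearForm
    (n := Fin (Module.finrank ℂ (symSubspace d k))) measurePreserving_neg_complexGaussian
  rw [avgError_eq hd, avgError_eq hd, ginibre, hA, hA, sum_norm_sq_symPairing_rho_sub_frameOp,
    sum_norm_sq_symPairing_rho_sub_frameOp]
  have := frobNorm_nonneg (frameOp k χ - rho d k)
  gcongr

/-- The squared distances are the two potentials minus the same constant. -/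
theorem frobNorm_le_frobNorm (hd : 0 < d) {ι κ : Type*} [Fintype ι] [Fintype κ] [Nonempty ι]
    [Nonempty κ] (χ : Frame d ι) (χ' : Frame d κ)
    (h : framePotential k χ ≤ framePotential k χ') :
    frobNorm (frameOp k χ - rho d k) ≤ frobNorm (frameOp k χ' - rho d k) := by
  have h1 := congrArg Complex.re (frobNorm_frameOp_sub_rho_sq (k := k) hd χ)
  have h2 := congrArg Complex.re (frobNorm_frameOp_sub_rho_sq (k := k) hd χ')
  rw [Complex.sub_re, Complex.ofReal_re, Complex.ofReal_re] at h1 h2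
  refine le_of_sq_le_sq ?_ (frobNorm_nonneg _)
  linarith

theorem isOptimalApproxDesign_of_framePotential_le (hd : 0 < d) {k' : ℕ} {ι : Type*} [Fintype ι]
    [Nonempty ι] (χ : Frame d ι) (hχ : IsDesign k' χ)
    (h : ∀ χ' : Frame d (Fin (Fintype.card ι)), IsDesign k' χ' →
      framePotential k χ ≤ framePotential k χ') : IsOptimalApproxDesign k' k χ := by
  refine ⟨hχ, fun χ' hχ' => ?_⟩
  have : Nonempty (Fin (Fintype.card ι)) := ⟨⟨0, Fintype.card_pos⟩⟩
  have h1 := frobNorm_le_frobNorm hd χ χ' (h χ' hχ')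
  exact ⟨h χ' hχ', h1, avgError_le_avgError hd χ χ' h1⟩

/-! ### Designs and frame operators -/

/-- The polynomial whose values are the entries of `|φ⟩⟨φ|^{⊗k}`. -/
def momentPoly (a b : Fin k → Fin d) : MvPolynomial (Fin d ⊕ Fin d) ℂ :=
  MvPolynomial.monomial
    (∑ r, Finsupp.single (Sum.inl (a r)) 1 + ∑ r, Finsupp.single (Sum.inr (b r)) 1) 1

theorem isBihomogeneous_momentPoly (a b : Fin k → Fin d) :
    IsBihomogeneous k (momentPoly a b) := by
  intro m hm
  rw [Finset.mem_singleton.1 (MvPolynomial.support_monomial_subset hm)]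
  simp only [Finsupp.add_apply, Finsupp.finsetSum_apply, Finsupp.single_apply]
  constructor
  · simp only [Sum.inl.injEq, reduceCtorEq, if_false, Finset.sum_const_zero, add_zero]
    rw [Finset.sum_comm]
    simp
  · simp only [Sum.inr.injEq, reduceCtorEq, if_false, Finset.sum_const_zero, zero_add]
    rw [Finset.sum_comm]
    simp

theorem evalAt_momentPoly (a b : Fin k → Fin d) : evalAt (momentPoly a b) = moment a b := by
  ext φ
  have : momentPoly a b =
      (∏ r, MvPolynomial.X (Sum.inl (a r))) * ∏ r, MvPolynomial.X (Sum.inr (b r)) := by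
    rw [momentPoly, ← one_mul (1 : ℂ), ← MvPolynomial.monomial_mul, MvPolynomial.monomial_sum_one,
      MvPolynomial.monomial_sum_one]
    rfl
  rw [evalAt, this]
  simp [moment, tensorPow]

/-- The witness is a word of length `k` in which the letter `i` occurs `m i` times. -/
theorem exists_tensorPow_eq (m : Fin d → ℕ) (hm : ∑ i, m i = k) :
    ∃ a : Fin k → Fin d, ∀ φ : H d, tensorPow k φ a = ∏ i, φ i ^ m i := by
  have e : Fin k ≃ Σ i, Fin (m i) := Fintype.equivOfCardEq (by simp [hm])
  refine ⟨fun r => (e r).1, fun φ => ?_⟩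
  change ∏ r, φ (e r).1 = _
  rw [Equiv.prod_comp e fun x => φ x.1, Fintype.prod_sigma]
  simp

theorem frameOp_eq_rho_of_isDesign (hd : 0 < d) {ι : Type*} [Fintype ι] {χ : Frame d ι}
    (h : IsDesign k χ) : frameOp k χ = rho d k := by
  ext a b
  rw [frameOp_apply, ← haarMean_moment hd, ← evalAt_momentPoly]
  exact (h _ (isBihomogeneous_momentPoly a b)).symm

/-- Every monomial of bidegree `(k, k)` is an entry of `|φ⟩⟨φ|^{⊗k}`, so a bihomogeneous polynomial
is a combination of moments. -/
theorem isDesign_of_frameOp_eq_rho (hd : 0 < d) {ι : Type*} [Fintype ι] {χ : Frame d ι}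
    (h : frameOp k χ = rho d k) : IsDesign k χ := by
  intro p hp
  have : NeZero d := ⟨hd.ne'⟩
  have hm : ∀ m : Fin d ⊕ Fin d →₀ ℕ, ∃ ab : (Fin k → Fin d) × (Fin k → Fin d), m ∈ p.support →
      ∀ φ : H d, moment ab.1 ab.2 φ =
        ∏ i, Sum.elim (fun i => φ i) (fun i => star (φ i)) i ^ m i := by
    intro m
    by_cases hs : m ∈ p.support
    · obtain ⟨a, ha⟩ := exists_tensorPow_eq (fun i => m (Sum.inl i)) (hp m hs).1
      obtain ⟨b, hb⟩ := exists_tensorPow_eq (fun i => m (Sum.inr i)) (hp m hs).2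
      refine ⟨(a, b), fun _ φ => ?_⟩
      rw [moment, ha, hb, Fintype.prod_sum_type]
      simp
    -- A dummy value off the support keeps the choice function total; it exists because `d` is
    -- nonzero.
    · exact ⟨(0, 0), fun h => absurd h hs⟩
  choose ab hab using hm
  have he : evalAt p = fun φ => ∑ m ∈ p.support, p.coeff m * moment (ab m).1 (ab m).2 φ := by
    ext φ
    rw [evalAt, MvPolynomial.eval_eq']
    exact Finset.sum_congr rfl fun m hm => by rw [hab m hm]
  rw [he, haarMean_sum_moment hd, frameMean_sum_moment, h]

/-- This is the partial trace over one tensor factor, which contributes `‖φ‖² = 1`. It lowers the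
order of a design by one; the factor `1 *` matches the shape of `haarMean_sum_moment`. -/
theorem sum_moment_cons (a b : Fin k → Fin d) {φ : H d} (h : ‖φ‖ = 1) :
    ∑ c, 1 * moment (Fin.cons c a) (Fin.cons c b : Fin (k + 1) → Fin d) φ = moment a b φ := by
  have h1 : ∑ c, φ c * star (φ c) = 1 := by
    have := inner_self_eq_norm_sq_to_K (𝕜 := ℂ) φ
    rw [h, PiLp.inner_apply] at this
    simpa only [RCLike.inner_apply, Complex.star_def, RCLike.ofReal_one, one_pow] using this
  have h2 : ∀ c, 1 * moment (Fin.cons c a) (Fin.cons c b : Fin (k + 1) → Fin d) φ =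
      φ c * star (φ c) * moment a b φ := by
    intro c
    simp only [moment, tensorPow, Fin.prod_univ_succ, Fin.cons_zero, Fin.cons_succ, star_mul']
    ring
  simp_rw [h2]
  rw [← Finset.sum_mul, h1, one_mul]

theorem frameOp_eq_rho_of_succ (hd : 0 < d) {ι : Type*} [Fintype ι] {χ : Frame d ι}
    (h : frameOp (k + 1) χ = rho d (k + 1)) : frameOp k χ = rho d k := by
  ext a b
  rw [frameOp_apply, ← haarMean_moment hd,
    ← haarMean_congr (fun φ hφ => sum_moment_cons a b hφ),
    ← frameMean_congr χ (fun φ hφ => sum_moment_cons a b hφ),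
    haarMean_sum_moment hd, frameMean_sum_moment, h]

theorem framePotential_of_frameOp_eq_rho (hd : 0 < d) {ι : Type*} [Fintype ι] [Nonempty ι]
    {χ : Frame d ι} (h : frameOp k χ = rho d k) :
    (framePotential k χ : ℂ) = 1 / (symProj d k).trace := by
  have h1 := frobNorm_frameOp_sub_rho_sq (k := k) hd χ
  have h2 : frobNorm (frameOp k χ - rho d k) = 0 := by simp [h, frobNorm]
  rw [h2] at h1
  rw [← sub_eq_zero, ← h1]
  simp

/-- Equality in the Welch bound makes the distance from `𝓕_k` to `ρ_k` vanish. -/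
theorem isDesign_of_framePotential (hd : 0 < d) {ι : Type*} [Fintype ι] [Nonempty ι]
    {χ : Frame d ι} (h : (framePotential k χ : ℂ) = 1 / (symProj d k).trace) : IsDesign k χ := by
  refine isDesign_of_frameOp_eq_rho hd ?_
  have h1 := frobNorm_frameOp_sub_rho_sq (k := k) hd χ
  rw [h, sub_self] at h1
  have h2 : frobNorm (frameOp k χ - rho d k) ^ 2 = 0 := by exact_mod_cast h1
  rw [frobNorm_sq, Finset.sum_eq_zero_iff_of_nonneg
    fun _ _ => Finset.sum_nonneg fun _ _ => sq_nonneg _] at h2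
  ext a b
  have h3 := (Finset.sum_eq_zero_iff_of_nonneg fun _ _ => sq_nonneg _).1
    (h2 a (Finset.mem_univ _)) b (Finset.mem_univ _)
  exact sub_eq_zero.1 (norm_eq_zero.1 (pow_eq_zero_iff two_ne_zero |>.1 h3))

theorem IsDesign.framePotential_one (hd : 0 < d) {ι : Type*} [Fintype ι] [Nonempty ι]
    {χ : Frame d ι} (h : IsDesign 1 χ) : framePotential 1 χ = 1 / (d : ℝ) := by
  have h1 := framePotential_of_frameOp_eq_rho hd (frameOp_eq_rho_of_isDesign hd h)
  rw [trace_symProj_one] at h1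
  apply Complex.ofReal_injective
  rw [h1]
  push_cast
  rfl

theorem framePotential_two_iff {ι : Type*} [Fintype ι] (χ : Frame d ι) :
    (framePotential 2 χ : ℂ) = 1 / (symProj d 2).trace ↔
      framePotential 2 χ = 2 / ((d : ℝ) * (d + 1)) := by
  rw [trace_symProj_two, one_div_div, ← Complex.ofReal_inj]
  push_cast
  rfl

theorem IsDesign.framePotential_two (hd : 0 < d) {ι : Type*} [Fintype ι] [Nonempty ι]
    {χ : Frame d ι} (h : IsDesign 2 χ) : framePotential 2 χ = 2 / ((d : ℝ) * (d + 1)) :=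
  (framePotential_two_iff χ).1
    (framePotential_of_frameOp_eq_rho hd (frameOp_eq_rho_of_isDesign hd h))

theorem IsDesign.of_succ (hd : 0 < d) {ι : Type*} [Fintype ι] {χ : Frame d ι}
    (h : IsDesign (k + 1) χ) : IsDesign k χ :=
  isDesign_of_frameOp_eq_rho hd (frameOp_eq_rho_of_succ hd (frameOp_eq_rho_of_isDesign hd h))

/-- The Welch bound of order two. -/
theorem welch_bound_two (hd : 0 < d) {ι : Type*} [Fintype ι] [Nonempty ι] (χ : Frame d ι) :
    2 / ((d : ℝ) * (d + 1)) ≤ framePotential 2 χ := by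
  have h1 := frobNorm_frameOp_sub_rho_sq (k := 2) hd χ
  rw [trace_symProj_two, one_div_div] at h1
  have h2 : frobNorm (frameOp 2 χ - rho d 2) ^ 2 =
      framePotential 2 χ - 2 / ((d : ℝ) * (d + 1)) := by
    apply Complex.ofReal_injective
    rw [h1]
    push_cast
    rfl
  have h3 := sq_nonneg (frobNorm (frameOp 2 χ - rho d 2))
  linarith

/-! ### Off-diagonal overlaps -/

/-- The sum of the `k`-th powers of the overlaps of distinct frame vectors. -/
def offDiagPotential {ι : Type*} [Fintype ι] [DecidableEq ι] (k : ℕ) (χ : Frame d ι) : ℝ :=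
  ∑ p ∈ (Finset.univ : Finset ι).offDiag, (‖inner ℂ (χ.vec p.1) (χ.vec p.2)‖ ^ 2) ^ k

theorem card_sq_mul_framePotential {ι : Type*} [Fintype ι] [Nonempty ι] [DecidableEq ι]
    (χ : Frame d ι) :
    (Fintype.card ι : ℝ) ^ 2 * framePotential k χ =
      Fintype.card ι + offDiagPotential k χ := by
  have hN : (Fintype.card ι : ℝ) ≠ 0 := by exact_mod_cast Fintype.card_ne_zero
  have h1 : ∀ i, ‖inner ℂ (χ.vec i) (χ.vec i)‖ = 1 := by
    intro i
    rw [inner_self_eq_norm_sq_to_K, χ.norm_vec]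
    simp
  rw [framePotential, ← mul_assoc, mul_one_div_cancel (pow_ne_zero 2 hN), one_mul,
    ← Finset.sum_product', ← Finset.diag_union_offDiag, Finset.sum_union
      (Finset.disjoint_diag_offDiag _), Finset.sum_diag, offDiagPotential]
  simp only [pow_mul, h1, one_pow]
  simp

/-- Cauchy–Schwarz, from `(x²)² = x · x³` for each squared overlap `x`. -/
theorem offDiagPotential_two_sq_le {ι : Type*} [Fintype ι] [DecidableEq ι] (χ : Frame d ι) :
    offDiagPotential 2 χ ^ 2 ≤ offDiagPotential 1 χ * offDiagPotential 3 χ :=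
  Finset.sum_sq_le_sum_mul_sum_of_sq_le_mul _ (fun _ _ => by positivity)
    (fun _ _ => by positivity) fun _ _ => le_of_eq (by ring)

theorem IsDesign.framePotential_three_ge_of_card (hd : 0 < d) {ι : Type*} [Fintype ι]
    (hι : Fintype.card ι = d * (d + 1)) {χ : Frame d ι} (h : IsDesign 1 χ) :
    1 / (d : ℝ) ^ 2 ≤ framePotential 3 χ := by
  classical
  have : Nonempty ι := Fintype.card_pos_iff.1 (by rw [hι]; positivity)
  have hd' : (0 : ℝ) < d := by exact_mod_cast hd
  have h1 := card_sq_mul_framePotential (k := 1) χ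
  have h2 := card_sq_mul_framePotential (k := 2) χ
  have h3 := card_sq_mul_framePotential (k := 3) χ
  have hw := welch_bound_two hd χ
  have hcs := offDiagPotential_two_sq_le χ
  rw [h.framePotential_one hd] at h1
  rw [hι] at h1 h2 h3
  push_cast at h1 h2 h3
  set N : ℝ := d * (d + 1) with hN
  have hN0 : 0 < N := by positivity
  have e1 : offDiagPotential 1 χ = N * d := by
    have : N ^ 2 * (1 / (d : ℝ)) = N + N * d := by rw [hN]; field_simp; ring
    linarith
  -- At size `N = d(d+1)` the Welch bound is `2 / N`; multiplying by `N²` and removing the diagonal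
  -- contribution `N` leaves `N`.
  have e2 : N ≤ offDiagPotential 2 χ := by
    have : N ^ 2 * (2 / N) = 2 * N := by field_simp
    nlinarith [mul_le_mul_of_nonneg_left hw (sq_nonneg N)]
  have e3 : N / d ≤ offDiagPotential 3 χ := by
    rw [e1] at hcs
    have : N ^ 2 ≤ N * d * offDiagPotential 3 χ := le_trans (by gcongr) hcs
    rw [div_le_iff₀ hd']
    refine le_of_mul_le_mul_left ?_ hN0
    linarith
  have e4 : N ^ 2 * (1 / (d : ℝ) ^ 2) = N + N / d := by rw [hN]; field_simp
  refine le_of_mul_le_mul_left ?_ (pow_pos hN0 2)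
  linarith

theorem IsDesign.framePotential_three_ge_of_card_sq (hd : 2 ≤ d) {ι : Type*} [Fintype ι]
    (hι : Fintype.card ι = d ^ 2) {χ : Frame d ι} (h : IsDesign 2 χ) :
    ((d : ℝ) + 3) / ((d : ℝ) * ((d : ℝ) + 1) ^ 2) ≤ framePotential 3 χ := by
  classical
  have hd0 : 0 < d := by omega
  have : Nonempty ι := Fintype.card_pos_iff.1 (by rw [hι]; positivity)
  have hd' : (2 : ℝ) ≤ d := by exact_mod_cast hd
  have hd1 : (0 : ℝ) < (d : ℝ) - 1 := by linarith
  have h1 := card_sq_mul_framePotential (k := 1) χ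
  have h2 := card_sq_mul_framePotential (k := 2) χ
  have h3 := card_sq_mul_framePotential (k := 3) χ
  have hcs := offDiagPotential_two_sq_le χ
  rw [(h.of_succ hd0).framePotential_one hd0] at h1
  rw [h.framePotential_two hd0] at h2
  rw [hι] at h1 h2 h3
  push_cast at h1 h2 h3
  set D : ℝ := (d : ℝ)
  have e1 : offDiagPotential 1 χ = D ^ 2 * (D - 1) := by
    have : (D ^ 2) ^ 2 * (1 / D) = D ^ 2 + D ^ 2 * (D - 1) := by field_simp; ring
    linarith
  have e2 : offDiagPotential 2 χ = D ^ 2 * (D - 1) / (D + 1) := by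
    have : (D ^ 2) ^ 2 * (2 / (D * (D + 1))) = D ^ 2 + D ^ 2 * (D - 1) / (D + 1) := by
      field_simp; ring
    linarith
  have e3 : D ^ 2 * (D - 1) / (D + 1) ^ 2 ≤ offDiagPotential 3 χ := by
    -- This is `S_1`, which has to be cancelled from Cauchy–Schwarz; it is positive because `d ≥ 2`.
    have hpos : 0 < D ^ 2 * (D - 1) := by positivity
    rw [e1, e2] at hcs
    refine le_of_mul_le_mul_left ?_ hpos
    calc _ = (D ^ 2 * (D - 1) / (D + 1)) ^ 2 := by rw [div_pow]; ring
      _ ≤ _ := hcs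
  have e4 : (D ^ 2) ^ 2 * ((D + 3) / (D * (D + 1) ^ 2)) = D ^ 2 + D ^ 2 * (D - 1) / (D + 1) ^ 2 := by
    field_simp
    ring
  refine le_of_mul_le_mul_left ?_ (by positivity : (0 : ℝ) < (D ^ 2) ^ 2)
  linarith

/-! ### Mutually unbiased bases and SICs -/

/-- Seen from one vector, its own basis contributes `1` and the `d²` vectors of the other bases
contribute `d⁻ᵏ` each. For `k = 0` the orthogonal pairs would count too, since `0 ^ 0 = 1`. -/
theorem CompleteMUB.framePotential_frame (hd : 0 < d) (B : CompleteMUB d) (hk : k ≠ 0) :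
    framePotential k B.frame =
      (1 + (d : ℝ) ^ 2 * (1 / (d : ℝ)) ^ k) / ((d : ℝ) * (d + 1)) := by
  have hx : ∀ α i β j, ‖inner ℂ (B.frame.vec (α, i)) (B.frame.vec (β, j))‖ ^ (2 * k) =
      if β = α then (if j = i then 1 else 0) else (1 / (d : ℝ)) ^ k := by
    intro α i β j
    change ‖inner ℂ (B.basis α i) (B.basis β j)‖ ^ (2 * k) = _
    split_ifs with h1 h2
    · subst h1 h2
      rw [(B.basis β).inner_eq_one]
      simp
    · subst h1
      rw [(B.basis β).inner_eq_zero (Ne.symm h2)]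
      simp [hk]
    · rw [pow_mul, B.unbiased α β (Ne.symm h1)]
  have hsum : ∀ α i, ∑ β, ∑ j, ‖inner ℂ (B.frame.vec (α, i)) (B.frame.vec (β, j))‖ ^ (2 * k) =
      1 + (d : ℝ) ^ 2 * (1 / (d : ℝ)) ^ k := by
    intro α i
    simp_rw [hx]
    rw [← Finset.add_sum_erase _ _ (Finset.mem_univ α)]
    congr 1
    · simp
    · rw [Finset.sum_congr rfl fun β hβ => by
        rw [Finset.sum_congr rfl fun j _ => if_neg (Finset.ne_of_mem_erase hβ)]]
      simp [Finset.card_erase_of_mem]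
      ring
  have hd' : (0 : ℝ) < d := by exact_mod_cast hd
  rw [framePotential]
  simp_rw [Fintype.sum_prod_type, hsum]
  simp only [Fintype.card_prod, Fintype.card_fin, Finset.sum_const, Finset.card_univ, nsmul_eq_mul]
  push_cast
  field_simp

theorem IsSIC.framePotential_eq (hd : 0 < d) {χ : Frame d (Fin (d ^ 2))} (h : IsSIC χ) :
    (d : ℝ) ^ 2 * framePotential k χ = 1 + ((d : ℝ) ^ 2 - 1) * (1 / ((d : ℝ) + 1)) ^ k := by
  have hd' : (0 : ℝ) < d := by exact_mod_cast hd
  have : Nonempty (Fin (d ^ 2)) := ⟨⟨0, by positivity⟩⟩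
  have h1 := card_sq_mul_framePotential (k := k) χ
  have h2 : offDiagPotential k χ = ((d : ℝ) ^ 2 * d ^ 2 - d ^ 2) * (1 / ((d : ℝ) + 1)) ^ k := by
    rw [offDiagPotential, Finset.sum_congr rfl fun p hp => by
      rw [h p.1 p.2 (Finset.mem_offDiag.1 hp).2.2], Finset.sum_const, nsmul_eq_mul,
      Finset.offDiag_card, Finset.card_univ, Fintype.card_fin, Nat.cast_sub (Nat.le_mul_self _)]
    push_cast
    rfl
  rw [h2, Fintype.card_fin] at h1
  push_cast at h1
  refine mul_left_cancel₀ (pow_pos hd' 2).ne' ?_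
  linear_combination h1

end ProjectiveDesign

end

/-! ### Assembly of the bounds and the optimality statements -/

open ProjectiveDesign
theorem mainTheorem4 (d : ℕ) (hd : 2 ≤ d) :
    (∀ χ : Frame d (Fin (d * (d + 1))), IsDesign 1 χ →
      1 / (d : ℝ) ^ 2 ≤ framePotential 3 χ) ∧
    (∀ B : CompleteMUB d,
      framePotential 3 B.frame = 1 / (d : ℝ) ^ 2 ∧
      IsDesign 2 B.frame ∧
      IsOptimalApproxDesign 1 3 B.frame) ∧
    (∀ χ : Frame d (Fin (d ^ 2)), IsDesign 2 χ →
      ((d : ℝ) + 3) / ((d : ℝ) * ((d : ℝ) + 1) ^ 2) ≤ framePotential 3 χ) ∧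
    (∀ χ : Frame d (Fin (d ^ 2)), IsSIC χ →
      framePotential 3 χ = ((d : ℝ) + 3) / ((d : ℝ) * ((d : ℝ) + 1) ^ 2) ∧
      IsOptimalApproxDesign 2 3 χ) := by
  have hd0 : 0 < d := by omega
  have hd' : (0 : ℝ) < d := by exact_mod_cast hd0
  refine ⟨fun χ h => h.framePotential_three_ge_of_card hd0 (by simp), fun B => ?_,
    fun χ h => h.framePotential_three_ge_of_card_sq hd (by simp), fun χ h => ?_⟩
  · have : NeZero d := ⟨hd0.ne'⟩
    have h3 : framePotential 3 B.frame = 1 / (d : ℝ) ^ 2 := by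
      rw [B.framePotential_frame hd0 (by norm_num)]
      field_simp
    have h2 : IsDesign 2 B.frame := by
      -- The second potential attains the Welch bound.
      refine isDesign_of_framePotential hd0 ((framePotential_two_iff _).2 ?_)
      rw [B.framePotential_frame hd0 (by norm_num)]
      field_simp
      norm_num
    refine ⟨h3, h2, isOptimalApproxDesign_of_framePotential_le hd0 _ (h2.of_succ hd0)
      fun χ' hχ' => ?_⟩
    rw [h3]
    exact hχ'.framePotential_three_ge_of_card hd0 (by simp [mul_comm])
  · have : Nonempty (Fin (d ^ 2)) := ⟨⟨0, by positivity⟩⟩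
    have h3 : framePotential 3 χ = ((d : ℝ) + 3) / ((d : ℝ) * ((d : ℝ) + 1) ^ 2) := by
      refine mul_left_cancel₀ (pow_pos hd' 2).ne' ?_
      rw [h.framePotential_eq hd0]
      field_simp
      ring
    have h2 : IsDesign 2 χ := by
      refine isDesign_of_framePotential hd0 ((framePotential_two_iff _).2 ?_)
      -- The Welch value is checked after multiplying by `d²`, the form in which
      -- `IsSIC.framePotential_eq` gives the potential.
      refine mul_left_cancel₀ (pow_pos hd' 2).ne' ?_
      rw [h.framePotential_eq hd0]
      field_simp
      ring
    refine ⟨h3, isOptimalApproxDesign_of_framePotential_le hd0 _ h2 fun χ' hχ' => ?_⟩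
    rw [h3]
    exact hχ'.framePotential_three_ge_of_card_sq hd (by simp)
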